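/- Let $d\ge 0$, let $\Omega\subset\mathbb R^{d+1}$ be a bounded open set with $C^\infty$ boundary $\Sigma=\partial\Omega$, with surface measure $\mu_\Sigma$, and suppose that $\Omega$ is equipped with a cylindrical exit: a $C^\infty$ diffeomorphism of the straight cylinder $\Sigma\times[0,1]$ onto a neighbourhood of $\Sigma$ in $\overline\Omega$ that maps $(y',1)$ to $y'$ for each $y'\in\Sigma$. Points $y$ of this neighbourhood are written $y=(y',y_{d+1})$, $y'\in\Sigma$, $y_{d+1}\in[0,1]$, so that $\Sigma=\{y_{d+1}=1\}$. A function $q$ on $\overline\Omega$ (scalar- or matrix-valued) is called $L_\infty(\Sigma)$-continuous at $\Sigma$ if it is bounded and measurable (up to null sets) for $y_{d+1}\in(1-\delta',1]$ with some $\delta'>0$, its values $q(\cdot,1)$ on $\Sigma$ belong to $L_\infty(\Sigma)$, and, with $q^\diamond(y',y_{d+1})=q(y',1)$ denoting the continuation of these values not depending on $y_{d+1}$, for every $x\in\Sigma$ $$\lim_{\delta\to0+}\|q-q^\diamond\|_{L_\infty(B(x,\delta)\cap\Omega)}=0 .$$ Let $\mathbb K=\mathbb R$ or $\mathbb C$.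 Matrices are normed by the operator norm on $\mathbb K^{d+1}$ with its Euclidean norm. Then there is a constant $c$, depending only on $\mathbb K$, $\Omega$ and its cylindrical exit, with the following property. Let $\mathfrak a\in L_\infty(\Omega)$ be a $(d+1)\times(d+1)$ matrix function with entries in $\mathbb K$, Hermitian almost everywhere in $\Omega$ and $L_\infty(\Sigma)$-continuous at $\Sigma$. Then for every $\varepsilon>0$ and every $p\in(0,\infty)$ there is a matrix function $\tilde{\mathfrak a}\in C^\infty(\overline\Omega)$ with values in the Hermitian $(d+1)\times(d+1)$ matrices over $\mathbb K$ such that 1. $\|\mathfrak a(\cdot,1)-\tilde{\mathfrak a}(\cdot,1)\|_{L_p(\Sigma)}<\varepsilon$; 2. $\mathfrak a-\tilde{\mathfrak a}$ is $L_\infty(\Sigma)$-continuous at $\Sigma$; 3. $\|\tilde{\mathfrak a}\|_{L_\infty(\Omega)}\le c\,\|\mathfrak a\|_{L_\infty(\Omega)}$; 4. if, additionally, $\mathfrak a$ is uniformly positive in $\Omega$ (that is, $\mathfrak a(y)\ge m\,I$ for almost every $y\in\Omega$ with some constant $m>0$), then $\tilde{\mathfrak a}(y)$ is positive definite for every $y\in\overline\Omega$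 and $\|\tilde{\mathfrak a}^{-1}\|_{L_\infty(\Omega)}\le c\,\|\mathfrak a^{-1}\|_{L_\infty(\Omega)}$. -/

import Mathlib

open Set Filter Topology MeasureTheory
open scoped ENNReal NNReal ContDiff ComplexOrder Matrix.Norms.L2Operator

/-- `Ω` has smooth (`C^∞`) boundary: near each boundary point it is the sublevel set of a smooth
function with nonvanishing differential there. -/
def HasSmoothBoundary {d : ℕ} (Ω : Set (EuclideanSpace ℝ (Fin (d + 1)))) : Prop :=
  ∀ x ∈ frontier Ω, ∃ (U : Set (EuclideanSpace ℝ (Fin (d + 1))))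
    (ρ : EuclideanSpace ℝ (Fin (d + 1)) → ℝ),
    IsOpen U ∧ x ∈ U ∧ ContDiffOn ℝ ∞ ρ U ∧ fderiv ℝ ρ x ≠ 0 ∧
      Ω ∩ U = {z | ρ z < 0} ∩ U

/-- The surface measure of `∂Ω`: the `d`-dimensional Hausdorff measure (normalized as in
Euclidean geometry) on `∂Ω ⊂ ℝ^{d+1}`. -/
noncomputable def surfaceMeasure {d : ℕ} (Ω : Set (EuclideanSpace ℝ (Fin (d + 1)))) :
    Measure (EuclideanSpace ℝ (Fin (d + 1))) :=
  μHE[d].restrict (frontier Ω)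

/-- A cylindrical exit of `Ω`: a `C^∞` diffeomorphism `(y', t) ↦ point (y', t)` of the straight
cylinder `∂Ω × [0, 1]` onto a neighbourhood of `∂Ω` in `closure Ω`, the top `t = 1` of the cylinder
being `∂Ω` itself. The inverse diffeomorphism is `y ↦ (base y, height y)`, that is,
`base y = y'` and `height y = y_{d+1}` are the coordinates of `y` in the cylinder. The values of
`point`, `base`, `height` outside the cylinder, resp. its image, are irrelevant. -/
structure CylindricalExit {d : ℕ} (Ω : Set (EuclideanSpace ℝ (Fin (d + 1)))) where
  point : EuclideanSpace ℝ (Fin (d + 1)) × ℝ → EuclideanSpace ℝ (Fin (d + 1))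
  base : EuclideanSpace ℝ (Fin (d + 1)) → EuclideanSpace ℝ (Fin (d + 1))
  height : EuclideanSpace ℝ (Fin (d + 1)) → ℝ
  point_mem : ∀ σ ∈ frontier Ω, ∀ t ∈ Icc (0 : ℝ) 1, point (σ, t) ∈ closure Ω
  point_one : ∀ σ ∈ frontier Ω, point (σ, 1) = σ
  base_point : ∀ σ ∈ frontier Ω, ∀ t ∈ Icc (0 : ℝ) 1, base (point (σ, t)) = σ
  height_point : ∀ σ ∈ frontier Ω, ∀ t ∈ Icc (0 : ℝ) 1, height (point (σ, t)) = t
  image_mem_nhdsWithin : ∀ σ ∈ frontier Ω,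
    point '' (frontier Ω ×ˢ Icc (0 : ℝ) 1) ∈ 𝓝[closure Ω] σ
  contDiffOn_point : ContDiffOn ℝ ∞ point (frontier Ω ×ˢ Icc (0 : ℝ) 1)
  contDiffOn_base : ContDiffOn ℝ ∞ base (point '' (frontier Ω ×ˢ Icc (0 : ℝ) 1))
  contDiffOn_height : ContDiffOn ℝ ∞ height (point '' (frontier Ω ×ˢ Icc (0 : ℝ) 1))

/-- The part `∂Ω × (1 - δ, 1]` of the cylinder, as a subset of `closure Ω`. -/
def CylindricalExit.strip {d : ℕ} {Ω : Set (EuclideanSpace ℝ (Fin (d + 1)))}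
    (K : CylindricalExit Ω) (δ : ℝ) : Set (EuclideanSpace ℝ (Fin (d + 1))) :=
  K.point '' (frontier Ω ×ˢ (Icc 0 1 ∩ Ioc (1 - δ) 1))

/-- `q` is `L_∞(∂Ω)`-continuous at `∂Ω`. The values of `q` on `∂Ω` are the limit function
`q(·, 1) ∈ L_∞(∂Ω)`, and `q ∘ K.base` is its continuation not depending on `y_{d+1}`. -/
def LinftyContinuousAtBoundary {d : ℕ} {Ω : Set (EuclideanSpace ℝ (Fin (d + 1)))}
    (K : CylindricalExit Ω) {F : Type*} [NormedAddCommGroup F]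
    (q : EuclideanSpace ℝ (Fin (d + 1)) → F) : Prop :=
  (∃ δ : ℝ, 0 < δ ∧ MemLp q ⊤ (volume.restrict (Ω ∩ K.strip δ))) ∧
  MemLp q ⊤ (surfaceMeasure Ω) ∧
  ∀ y ∈ frontier Ω,
    Tendsto (fun δ : ℝ => eLpNorm (fun z => q z - q (K.base z)) ⊤
      (volume.restrict (Metric.ball y δ ∩ Ω))) (𝓝[>] 0) (𝓝 0)

/-- `a ≥ m I` almost everywhere in `Ω`, with a constant `m > 0`. -/
def UniformlyPositive {d : ℕ} {𝕜 : Type*} [RCLike 𝕜] (Ω : Set (EuclideanSpace ℝ (Fin (d + 1))))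
    (a : EuclideanSpace ℝ (Fin (d + 1)) → Matrix (Fin (d + 1)) (Fin (d + 1)) 𝕜) : Prop :=
  ∃ m : ℝ, 0 < m ∧ ∀ᵐ y ∂(volume.restrict Ω), (a y - (m : 𝕜) • 1).PosSemidef

/-! For nonempty `Ω` the constant `c = 1` suffices. The Hermitian matrices with spectrum in `[m, M]`
are exactly `hermitianBall` with centre `(M + m) / 2` and radius `(M - m) / 2`, a closed convex set
onto which all matrices retract continuously. With `M = ‖a‖_∞`, and `m ≥ ‖a⁻¹‖_∞⁻¹` a lower bound of
the spectrum in the uniformly positive case, or with `m = -M` otherwise, membership in this ball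
encodes every bound required of `b`. It remains to approximate the boundary values of `a` by smooth
functions with values in the ball.

Two facts carry this. First, the boundary values lie in the ball almost everywhere for the surface
measure (`CylindricalExit.ae_mem_of_isClosed`). A set of bad boundary points has below it, inside
`Ω`, a piece of collar of volume zero, and a volume-null collar forces a null base, by Eilenberg's
inequality and the local Lipschitz bound for `(base, height)`. Second, a function with values in the
ball is an `L_p` limit of smooth ones with values there
(`exists_contDiff_mem_convex_eLpNorm_sub_lt`): approximate by continuous functions, retract, then
smooth by a partition of unity, which convexity permits. The resulting `b` is smooth on the whole
space, so subtracting it preserves `L_∞`-continuity at the boundary. -/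

/-! ### Hausdorff measure of products and of locally Lipschitz images -/

/-- A case of Eilenberg's inequality for the product with a subset of the line. -/
theorem hausdorffMeasure_mul_volume_le {X : Type*} [MetricSpace X] [SecondCountableTopology X]
    [MeasurableSpace X] [BorelSpace X] {s : ℝ} (hs : 0 ≤ s) (N : Set X) (I : Set ℝ) :
    μH[s] N * volume I ≤ μH[s + 1] (N ×ˢ I) := by
  by_cases hfin : μH[s + 1] (N ×ˢ I) = ⊤
  · simp [hfin]
  have hs1 : s + 1 ≠ 0 := by positivity
  set H := μH[s + 1] (N ×ˢ I) with hH
  have hcov : ∀ n : ℕ, ∃ t : ℕ → Set (X × ℝ), N ×ˢ I ⊆ ⋃ i, t i ∧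
      (∀ i, Metric.ediam (t i) ≤ ((n : ℝ≥0∞) + 1)⁻¹) ∧
      ∑' i, (⨆ _ : (t i).Nonempty, Metric.ediam (t i) ^ (s + 1)) ≤ H + ((n : ℝ≥0∞) + 1)⁻¹ := by
    intro n
    have h1 : (0 : ℝ≥0∞) < ((n : ℝ≥0∞) + 1)⁻¹ := by
      rw [ENNReal.inv_pos]; finiteness
    have h2 := Measure.hausdorffMeasure_apply (s + 1) (N ×ˢ I)
    have h3 : (⨅ (t : ℕ → Set (X × ℝ)) (_ : N ×ˢ I ⊆ ⋃ n, t n)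
        (_ : ∀ i, Metric.ediam (t i) ≤ ((n : ℝ≥0∞) + 1)⁻¹),
          ∑' i, ⨆ _ : (t i).Nonempty, Metric.ediam (t i) ^ (s + 1)) <
          H + ((n : ℝ≥0∞) + 1)⁻¹ := by
      refine lt_of_le_of_lt ?_ (ENNReal.lt_add_right hfin h1.ne')
      rw [hH, h2]
      exact le_iSup₂_of_le _ h1 le_rfl
    simp only [iInf_lt_iff] at h3
    obtain ⟨t, ht1, ht2, ht3⟩ := h3
    exact ⟨t, ht1, ht2, ht3.le⟩
  choose t htc htd hts using hcov
  -- The closure makes the projections measurable without changing their diameters.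
  set J : ℕ → ℕ → Set ℝ := fun n i => closure (Prod.snd '' t n i) with hJ
  have hJm : ∀ n i, MeasurableSet (J n i) := fun n i => isClosed_closure.measurableSet
  have hJd : ∀ n i, volume (J n i) ≤ Metric.ediam (t n i) := by
    intro n i
    refine (Real.volume_le_diam _).trans ?_
    rw [hJ, Metric.ediam_closure]
    refine (LipschitzWith.prod_snd.ediam_image_le _).trans ?_
    simp
  -- `f n u` bounds the `s`-dimensional sum for the cover of `N` cut out at height `u`; its integral
  -- is bounded by the `(s + 1)`-dimensional sum, and Fatou's lemma concludes.
  set f : ℕ → ℝ → ℝ≥0∞ := fun n u =>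
    ∑' i, (J n i).indicator (fun _ => Metric.ediam (t n i) ^ s) u with hf
  have hfm : ∀ n, Measurable (f n) := fun n =>
    Measurable.tsum fun i => measurable_const.indicator (hJm n i)
  have hfint : ∀ n, ∫⁻ u, f n u ≤ H + ((n : ℝ≥0∞) + 1)⁻¹ := by
    intro n
    rw [hf, lintegral_tsum fun i => (measurable_const.indicator (hJm n i)).aemeasurable]
    refine le_trans (ENNReal.tsum_le_tsum fun i => ?_) (hts n)
    rw [lintegral_indicator_const (hJm n i)]
    rcases (t n i).eq_empty_or_nonempty with he | hne
    · simp [hJ, he]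
    · simp only [hne, iSup_pos]
      rw [ENNReal.rpow_add_of_nonneg _ _ hs zero_le_one, ENNReal.rpow_one]
      gcongr
      exact hJd n i
  have hle : ∀ u ∈ I, μH[s] N ≤ liminf (fun n => f n u) atTop := by
    intro u hu
    have hr : Tendsto (fun n : ℕ => ((n : ℝ≥0∞) + 1)⁻¹) atTop (𝓝 0) := by
      have := ENNReal.tendsto_inv_nat_nhds_zero.comp (tendsto_add_atTop_nat 1)
      simpa [Function.comp_def] using this
    have key := Measure.hausdorffMeasure_le_liminf_tsum
      (ι := fun n : ℕ => {i : ℕ // u ∈ J n i}) s N (l := atTop) _ hr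
      (fun n i => Prod.fst '' (t n i.1 ∩ Prod.snd ⁻¹' {u})) ?_ ?_
    · refine key.trans (liminf_le_liminf (Eventually.of_forall fun n => ?_))
      rw [hf]
      simp only
      rw [← tsum_subtype_eq_of_support_subset (s := {i | u ∈ J n i})]
      · refine ENNReal.tsum_le_tsum fun i => ?_
        rw [indicator_of_mem i.2]
        refine ENNReal.rpow_le_rpow ?_ hs
        refine (LipschitzWith.prod_fst.ediam_image_le _).trans ?_
        rw [ENNReal.coe_one, one_mul]
        exact Metric.ediam_mono inter_subset_left
      · intro i hi
        by_contra hcon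
        exact hi (indicator_of_notMem (s := J n i) hcon _)
    · refine Eventually.of_forall fun n i => ?_
      refine (LipschitzWith.prod_fst.ediam_image_le _).trans ?_
      rw [ENNReal.coe_one, one_mul]
      exact (Metric.ediam_mono inter_subset_left).trans (htd n i)
    · refine Eventually.of_forall fun n x hx => ?_
      obtain ⟨i, hi⟩ := mem_iUnion.1 (htc n (mk_mem_prod hx hu))
      exact mem_iUnion.2 ⟨⟨i, subset_closure ⟨_, hi, rfl⟩⟩, (x, u), ⟨hi, rfl⟩, rfl⟩
  calc μH[s] N * volume I = ∫⁻ u in I, μH[s] N := by simp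
    _ ≤ ∫⁻ u in I, liminf (fun n => f n u) atTop :=
        setLIntegral_mono (Measurable.liminf hfm) hle
    _ ≤ ∫⁻ u, liminf (fun n => f n u) atTop := setLIntegral_le_lintegral _ _
    _ ≤ liminf (fun n => ∫⁻ u, f n u) atTop := lintegral_liminf_le hfm
    _ ≤ liminf (fun n : ℕ => H + ((n : ℝ≥0∞) + 1)⁻¹) atTop :=
        liminf_le_liminf (Eventually.of_forall hfint)
    _ = H := by
        refine Tendsto.liminf_eq ?_
        have := ENNReal.tendsto_inv_nat_nhds_zero.comp (tendsto_add_atTop_nat 1)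
        simpa [Function.comp_def] using this.const_add H

/-- A map that is `L`-Lipschitz near each point of `A` (with the same `L`) expands the
`s`-dimensional Hausdorff measure of `A` at most `L ^ s` times. -/
theorem hausdorffMeasure_image_le_of_locally {X Y : Type*} [MetricSpace X]
    [SecondCountableTopology X] [MeasurableSpace X] [BorelSpace X] [MetricSpace Y]
    [MeasurableSpace Y] [BorelSpace Y] {f : X → Y} {L : ℝ≥0} {s : ℝ} (hs : 0 ≤ s) {A : Set X}
    (hA : ∀ x ∈ A, ∃ U, IsOpen U ∧ x ∈ U ∧ LipschitzOnWith L f U) :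
    μH[s] (f '' A) ≤ (L : ℝ≥0∞) ^ s * μH[s] A := by
  choose! U hUo hxU hUL using hA
  obtain ⟨T, hTA, hTc, hTU⟩ := TopologicalSpace.countable_cover_nhdsWithin
    (f := fun x => U x) (s := A)
    fun x hx => mem_nhdsWithin_of_mem_nhds ((hUo x hx).mem_nhds (hxU x hx))
  rcases T.eq_empty_or_nonempty with rfl | hTne
  · have : A = ∅ := by simpa using hTU
    simp [this]
  obtain ⟨e, he⟩ := hTc.exists_eq_range hTne
  have heA : ∀ n, e n ∈ A := fun n => hTA (he ▸ mem_range_self n)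
  set V : ℕ → Set X := disjointed fun n => U (e n) with hV
  have hVm : ∀ n, MeasurableSet (V n) :=
    fun n => MeasurableSet.disjointed (fun k => (hUo _ (heA k)).measurableSet) n
  have hVd : Pairwise (Function.onFun Disjoint V) := disjoint_disjointed _
  have hAV : A ⊆ ⋃ n, V n := by
    rw [hV, iUnion_disjointed]
    refine hTU.trans ?_
    rw [he, biUnion_range]
  calc μH[s] (f '' A) ≤ μH[s] (⋃ n, f '' (V n ∩ A)) := by
        refine measure_mono ?_
        rw [← image_iUnion, ← iUnion_inter, inter_eq_right.2 hAV]
    _ ≤ ∑' n, μH[s] (f '' (V n ∩ A)) := measure_iUnion_le _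
    _ ≤ ∑' n, (L : ℝ≥0∞) ^ s * μH[s] (V n ∩ A) := by
        refine ENNReal.tsum_le_tsum fun n => ?_
        exact ((hUL _ (heA n)).mono (inter_subset_left.trans
          (disjointed_subset _ n))).hausdorffMeasure_image_le hs
    _ = (L : ℝ≥0∞) ^ s * ∑' n, (μH[s]).restrict A (V n) := by
        rw [ENNReal.tsum_mul_left]
        simp_rw [Measure.restrict_apply (hVm _)]
    _ = (L : ℝ≥0∞) ^ s * (μH[s]).restrict A (⋃ n, V n) := by
        rw [measure_iUnion hVd hVm]
    _ ≤ (L : ℝ≥0∞) ^ s * μH[s] A := by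
        refine mul_le_mul_right ?_ _
        exact (measure_mono (subset_univ _)).trans_eq (Measure.restrict_apply_univ _)

/-- The derivative stays bounded by `‖f' x‖ + 1` near `x`, and the mean value inequality applies on
small balls inside `Ω`. The part of `Ω` near `x` need not be convex, so the constant is uniform but
the Lipschitz bound is only local; Hausdorff measure needs no more. -/
theorem ContDiffWithinAt.exists_lipschitzOnWith_nhds_of_isOpen {E F : Type*}
    [NormedAddCommGroup E] [NormedSpace ℝ E] [NormedAddCommGroup F] [NormedSpace ℝ F]
    {f : E → F} {S Ω : Set E} {x : E} (hf : ContDiffWithinAt ℝ 1 f S x) (hΩ : IsOpen Ω)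
    (hx : x ∈ closure Ω) (hS : S ∈ 𝓝[closure Ω] x) :
    ∃ L : ℝ≥0, ∃ δ > 0, ∀ z ∈ Metric.ball x δ ∩ Ω,
      ∃ U, IsOpen U ∧ z ∈ U ∧ LipschitzOnWith L f U := by
  obtain ⟨u, hu, -, f', hf', hc⟩ :=
    (contDiffWithinAt_succ_iff_hasFDerivWithinAt (n := 0) (by simp)).1 (by simpa using hf)
  have hxS : x ∈ S := mem_of_mem_nhdsWithin hx hS
  rw [insert_eq_of_mem hxS] at hu
  have hu' : u ∈ 𝓝[closure Ω] x := by
    have h1 : 𝓝[closure Ω] x ≤ 𝓝[S] x := le_inf inf_le_left (le_principal_iff.2 hS)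
    exact h1 hu
  have hxu : x ∈ u := mem_of_mem_nhdsWithin hx hu'
  have hb : ∀ᶠ y in 𝓝[u] x, ‖f' y‖ < ‖f' x‖ + 1 :=
    hc.continuousWithinAt.norm.eventually_lt_const (by linarith)
  have hb' : {y | y ∈ u ∧ ‖f' y‖ < ‖f' x‖ + 1} ∈ 𝓝[closure Ω] x := by
    have h1 : 𝓝[closure Ω] x ≤ 𝓝[u] x := le_inf inf_le_left (le_principal_iff.2 hu')
    exact inter_mem hu' (h1 hb)
  obtain ⟨δ, hδ, hsub⟩ := Metric.mem_nhdsWithin_iff.1 hb'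
  refine ⟨‖f' x‖₊ + 1, δ, hδ, fun z hz => ?_⟩
  have hop : IsOpen (Metric.ball x δ ∩ Ω) := Metric.isOpen_ball.inter hΩ
  obtain ⟨η, hη, hball⟩ := Metric.isOpen_iff.1 hop z hz
  have hin : ∀ y ∈ Metric.ball z η, y ∈ u ∧ ‖f' y‖ < ‖f' x‖ + 1 := fun y hy =>
    hsub ⟨(hball hy).1, subset_closure (hball hy).2⟩
  refine ⟨Metric.ball z η, Metric.isOpen_ball, Metric.mem_ball_self hη, ?_⟩
  refine (convex_ball z η).lipschitzOnWith_of_nnnorm_hasFDerivWithin_le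
    (fun y hy => (hf' y (hin y hy).1).mono fun w hw => (hin w hw).1) fun y hy => ?_
  rw [← NNReal.coe_le_coe]
  simpa using (hin y hy).2.le

/-! ### The collar: surface measure and boundary values -/

namespace CylindricalExit

variable {d : ℕ} {Ω : Set (EuclideanSpace ℝ (Fin (d + 1)))}

theorem mem_image (K : CylindricalExit Ω) {x : EuclideanSpace ℝ (Fin (d + 1))}
    (hx : x ∈ frontier Ω) : x ∈ K.point '' (frontier Ω ×ˢ Icc (0 : ℝ) 1) :=
  ⟨(x, 1), ⟨hx, by simp⟩, K.point_one x hx⟩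

theorem base_eq (K : CylindricalExit Ω) {x : EuclideanSpace ℝ (Fin (d + 1))}
    (hx : x ∈ frontier Ω) : K.base x = x := by
  simpa [K.point_one x hx] using K.base_point x hx 1 (by simp)

theorem height_eq (K : CylindricalExit Ω) {x : EuclideanSpace ℝ (Fin (d + 1))}
    (hx : x ∈ frontier Ω) : K.height x = 1 := by
  simpa [K.point_one x hx] using K.height_point x hx 1 (by simp)

theorem point_mem_of_lt_one (K : CylindricalExit Ω) (hΩ : IsOpen Ω)
    {x : EuclideanSpace ℝ (Fin (d + 1))} (hx : x ∈ frontier Ω) {t : ℝ} (ht : 0 ≤ t) (ht1 : t < 1) :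
    K.point (x, t) ∈ Ω := by
  by_contra h
  have hfr : K.point (x, t) ∈ frontier Ω := by
    rw [hΩ.frontier_eq]
    exact ⟨K.point_mem x hx t ⟨ht, ht1.le⟩, h⟩
  have h1 := K.height_eq hfr
  rw [K.height_point x hx t ⟨ht, ht1.le⟩] at h1
  exact ht1.ne h1

theorem tendsto_base (K : CylindricalExit Ω) {x : EuclideanSpace ℝ (Fin (d + 1))}
    (hx : x ∈ frontier Ω) : Tendsto K.base (𝓝[closure Ω] x) (𝓝 x) := by
  have h := (K.contDiffOn_base x (K.mem_image hx)).continuousWithinAt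
  rw [ContinuousWithinAt, K.base_eq hx] at h
  exact h.mono_left (le_inf inf_le_left (le_principal_iff.2 (K.image_mem_nhdsWithin x hx)))

/-- Near a boundary point, the surface measure is controlled by the volume of the part of the
collar lying over a given boundary set. -/
theorem exists_euclideanHausdorffMeasure_le (K : CylindricalExit Ω) (hΩ : IsOpen Ω)
    {x : EuclideanSpace ℝ (Fin (d + 1))} (hx : x ∈ frontier Ω) {δ : ℝ} (hδ : 0 < δ) :
    ∃ ρ > 0, ∃ C : ℝ≥0∞, C ≠ ⊤ ∧ ∀ N ⊆ frontier Ω ∩ Metric.ball x ρ,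
      μHE[d] N ≤ C * volume {z | z ∈ Metric.ball x δ ∩ Ω ∧ K.base z ∈ N} := by
  set S := K.point '' (frontier Ω ×ˢ Icc (0 : ℝ) 1) with hS
  have hxS : x ∈ S := K.mem_image hx
  have hxc : x ∈ closure Ω := frontier_subset_closure hx
  have hF : ContDiffWithinAt ℝ 1 (fun z => (K.base z, K.height z)) S x :=
    ((K.contDiffOn_base x hxS).of_le (by norm_cast)).prodMk
      ((K.contDiffOn_height x hxS).of_le (by norm_cast))
  obtain ⟨L, δ₁, hδ₁, hL⟩ :=
    hF.exists_lipschitzOnWith_nhds_of_isOpen hΩ hxc (K.image_mem_nhdsWithin x hx)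
  set η := min δ δ₁ with hη
  have hη0 : 0 < η := lt_min hδ hδ₁
  have hp : ContinuousWithinAt K.point (frontier Ω ×ˢ Icc (0 : ℝ) 1) (x, 1) :=
    (K.contDiffOn_point (x, 1) ⟨hx, by simp⟩).continuousWithinAt
  have hp' : K.point ⁻¹' Metric.ball x η ∈ 𝓝[frontier Ω ×ˢ Icc (0 : ℝ) 1] (x, 1) := by
    refine hp ?_
    rw [K.point_one x hx]
    exact Metric.ball_mem_nhds x hη0
  obtain ⟨ρ, hρ, hsub⟩ := Metric.mem_nhdsWithin_iff.1 hp'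
  set τ := min ρ 1 with hτ
  have hτ0 : 0 < τ := lt_min hρ one_pos
  obtain ⟨k, hk⟩ : ∃ k : ℝ≥0, (μHE[d] : Measure (EuclideanSpace ℝ (Fin (d + 1)))) = k • μH[d] :=
    ⟨_, rfl⟩
  obtain ⟨k', hk0, hk'⟩ : ∃ k' : ℝ≥0, k' ≠ 0 ∧
      (volume : Measure (EuclideanSpace ℝ (Fin (d + 1)))) = k' • μH[(d + 1 : ℕ)] := by
    rw [← EuclideanSpace.euclideanHausdorffMeasure_eq_volume]
    exact ⟨_, Measure.addHaarScalarFactor_volume_hausdorffMeasure_ne_zero _, rfl⟩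
  have hkey : ∀ N ⊆ frontier Ω ∩ Metric.ball x ρ, μH[d] N * ENNReal.ofReal τ ≤
      (L : ℝ≥0∞) ^ ((d : ℝ) + 1) *
        μH[(d : ℝ) + 1] {z | z ∈ Metric.ball x δ ∩ Ω ∧ K.base z ∈ N} := by
    intro N hN
    -- The interval omits `1`, so the collar over `N` lies in the open set `Ω`, where the Lipschitz
    -- bound holds.
    have h1 := hausdorffMeasure_mul_volume_le (s := (d : ℝ)) (by positivity) N (Ioo (1 - τ) 1)
    rw [Real.volume_Ioo, sub_sub_cancel] at h1
    refine h1.trans ?_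
    set Z := {z | z ∈ Metric.ball x η ∩ Ω ∧ K.base z ∈ N} with hZ
    have h2 : N ×ˢ Ioo (1 - τ) 1 ⊆ (fun z => (K.base z, K.height z)) '' Z := by
      rintro ⟨σ, t⟩ ⟨hσ, ht1, ht2⟩
      simp only at hσ ht1 ht2
      have hσf := (hN hσ).1
      have ht0 : 0 ≤ t := by linarith [min_le_right ρ 1]
      have htI : t ∈ Icc (0 : ℝ) 1 := ⟨ht0, ht2.le⟩
      have hb := K.base_point σ hσf t htI
      refine ⟨K.point (σ, t), ⟨⟨?_, K.point_mem_of_lt_one hΩ hσf ht0 ht2⟩, ?_⟩, ?_⟩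
      · refine hsub ⟨?_, ⟨hσf, htI⟩⟩
        rw [← ball_prod_same]
        refine ⟨(hN hσ).2, ?_⟩
        rw [Metric.mem_ball, Real.dist_eq, abs_lt]
        constructor <;> linarith [min_le_left ρ 1]
      · rw [hb]; exact hσ
      · simp [hb, K.height_point σ hσf t htI]
    refine (measure_mono h2).trans ((hausdorffMeasure_image_le_of_locally (L := L) (by positivity)
      fun z hz => hL z ⟨Metric.ball_subset_ball (min_le_right _ _) hz.1.1, hz.1.2⟩).trans ?_)
    refine mul_le_mul_right (measure_mono fun z hz => ?_) _
    exact ⟨⟨Metric.ball_subset_ball (min_le_left _ _) hz.1.1, hz.1.2⟩, hz.2⟩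
  have hτe : ENNReal.ofReal τ ≠ 0 := by simpa using hτ0
  refine ⟨ρ, hρ, k * ((ENNReal.ofReal τ)⁻¹ * (L : ℝ≥0∞) ^ ((d : ℝ) + 1) * (k' : ℝ≥0∞)⁻¹), ?_, ?_⟩
  · have h1 : (k' : ℝ≥0∞)⁻¹ ≠ ⊤ := by simpa using hk0
    have h2 : (ENNReal.ofReal τ)⁻¹ ≠ ⊤ := by simpa using hτ0
    have h3 : (L : ℝ≥0∞) ^ ((d : ℝ) + 1) ≠ ⊤ :=
      ENNReal.rpow_ne_top_of_nonneg (by positivity) ENNReal.coe_ne_top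
    exact ENNReal.mul_ne_top ENNReal.coe_ne_top (ENNReal.mul_ne_top (ENNReal.mul_ne_top h2 h3) h1)
  · intro N hN
    have h := hkey N hN
    set W := {z | z ∈ Metric.ball x δ ∩ Ω ∧ K.base z ∈ N}
    have hW : μH[(d : ℝ) + 1] W = (k' : ℝ≥0∞)⁻¹ * volume W := by
      rw [hk', Measure.smul_apply, ENNReal.smul_def, smul_eq_mul, ← mul_assoc,
        ENNReal.inv_mul_cancel (by simpa using hk0) ENNReal.coe_ne_top, one_mul]
      push_cast; rfl
    rw [hk, Measure.smul_apply, ENNReal.smul_def, smul_eq_mul]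
    rw [mul_assoc (k : ℝ≥0∞)]
    gcongr
    rw [hW] at h
    rw [mul_assoc, mul_assoc, mul_comm (ENNReal.ofReal τ)⁻¹, ← div_eq_mul_inv,
      ENNReal.le_div_iff_mul_le (Or.inl hτe) (Or.inl ENNReal.ofReal_ne_top)]
    simpa [mul_assoc] using h

/-- The boundary is compact, and each of its points has a patch whose measure is at most a finite
multiple of the volume of a unit ball. -/
theorem isFiniteMeasure_surfaceMeasure (K : CylindricalExit Ω) (hΩ : IsOpen Ω)
    (hb : Bornology.IsBounded Ω) : IsFiniteMeasure (surfaceMeasure Ω) := by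
  have hc : IsCompact (frontier Ω) :=
    Metric.isCompact_of_isClosed_isBounded isClosed_frontier
      (hb.closure.subset frontier_subset_closure)
  refine ⟨?_⟩
  rw [surfaceMeasure, Measure.restrict_apply_univ]
  refine hc.measure_lt_top_of_nhdsWithin fun x hx => ?_
  obtain ⟨ρ, hρ, C, hC, h⟩ := K.exists_euclideanHausdorffMeasure_le hΩ hx one_pos
  refine ⟨frontier Ω ∩ Metric.ball x ρ, inter_mem_nhdsWithin _ (Metric.ball_mem_nhds x hρ), ?_⟩
  refine (h _ subset_rfl).trans_lt (ENNReal.mul_lt_top hC.lt_top ?_)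
  refine (measure_mono (t := Metric.ball x 1) fun z hz => hz.1.1).trans_lt measure_ball_lt_top

/-- A closed condition satisfied almost everywhere in `Ω` is inherited by the boundary values. -/
theorem ae_mem_of_isClosed (K : CylindricalExit Ω) (hΩ : IsOpen Ω) {F : Type*}
    [NormedAddCommGroup F] {q : EuclideanSpace ℝ (Fin (d + 1)) → F}
    (hq : LinftyContinuousAtBoundary K q) {S : Set F} (hS : IsClosed S)
    (hqS : ∀ᵐ y ∂(volume.restrict Ω), q y ∈ S) : ∀ᵐ y ∂(surfaceMeasure Ω), q y ∈ S := by
  have hmain : ∀ n : ℕ, ∀ᵐ y ∂(surfaceMeasure Ω),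
      ∃ w ∈ S, ‖w - q y‖ ≤ 1 / ((n : ℝ) + 1) := by
    intro n
    have hn : (0 : ℝ) < 1 / ((n : ℝ) + 1) := by positivity
    rw [surfaceMeasure, ae_restrict_iff' isClosed_frontier.measurableSet]
    -- `B` is not shown to be measurable; the collar estimate holds for arbitrary sets.
    set B := {y | ¬ (y ∈ frontier Ω → ∃ w ∈ S, ‖w - q y‖ ≤ 1 / ((n : ℝ) + 1))} with hB
    have hBf : B ⊆ frontier Ω := fun y hy => by
      simp only [hB, mem_ofPred_eq, Classical.not_imp] at hy
      exact hy.1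
    change μHE[d] B = 0
    refine measure_null_of_locally_null B fun x hxB => ?_
    have hx := hBf hxB
    have h1 := (hq.2.2 x hx).eventually_lt_const
      (show (0 : ℝ≥0∞) < ENNReal.ofReal (1 / ((n : ℝ) + 1)) by simpa using hn)
    obtain ⟨δ, hδ, hδ0⟩ := (h1.and self_mem_nhdsWithin).exists
    have hδ0 : 0 < δ := hδ0
    obtain ⟨ρ, hρ, C, -, h⟩ := K.exists_euclideanHausdorffMeasure_le hΩ hx hδ0
    refine ⟨B ∩ Metric.ball x ρ, inter_mem_nhdsWithin _ (Metric.ball_mem_nhds x hρ), ?_⟩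
    refine le_antisymm ((h _ (inter_subset_inter_left _ hBf)).trans ?_) zero_le
    suffices hz : volume {z | z ∈ Metric.ball x δ ∩ Ω ∧ K.base z ∈ B ∩ Metric.ball x ρ} = 0 by
      rw [hz, mul_zero]
    have hae1 : ∀ᵐ z ∂(volume.restrict (Metric.ball x δ ∩ Ω)),
        ‖q z - q (K.base z)‖ ≤ 1 / ((n : ℝ) + 1) := by
      rw [eLpNorm_exponent_top] at hδ
      filter_upwards [ae_le_eLpNormEssSup (f := fun z => q z - q (K.base z))
        (μ := volume.restrict (Metric.ball x δ ∩ Ω))] with z hz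
      have h2 := hz.trans hδ.le
      rwa [← ofReal_norm, ENNReal.ofReal_le_ofReal_iff hn.le] at h2
    have hae2 : ∀ᵐ z ∂(volume.restrict (Metric.ball x δ ∩ Ω)), q z ∈ S :=
      ae_mono (Measure.restrict_mono inter_subset_right le_rfl) hqS
    have hae := (ae_restrict_iff' (Metric.isOpen_ball.inter hΩ).measurableSet).1 (hae1.and hae2)
    -- Over a point of `B`, a `z` with both properties would make `q z` the forbidden witness.
    refine measure_mono_null ?_ (ae_iff.1 hae)
    rintro z ⟨hzb, hzB, -⟩ hcon
    obtain ⟨hc1, hc2⟩ := hcon hzb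
    exact hzB fun _ => ⟨q z, hc2, hc1⟩
  filter_upwards [ae_all_iff.2 hmain] with y hy
  rw [← hS.closure_eq, Metric.mem_closure_iff]
  intro ε hε
  obtain ⟨n, hn⟩ := exists_nat_one_div_lt hε
  obtain ⟨w, hw, hw'⟩ := hy n
  refine ⟨w, hw, ?_⟩
  rw [dist_comm, dist_eq_norm]
  exact hw'.trans_lt hn

end CylindricalExit

/-! ### Smooth approximation with values in a convex set -/

-- Locally the constant `g x` is admissible, and a partition of unity glues these constants because
-- `C ∩ ball (g x) ε` is convex.
open scoped Manifold in
theorem Continuous.exists_contDiff_dist_lt_mem_convex {E F : Type*} [NormedAddCommGroup E]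
    [NormedSpace ℝ E] [FiniteDimensional ℝ E] [NormedAddCommGroup F] [NormedSpace ℝ F]
    {g : E → F} (hg : Continuous g) {C : Set F} (hC : Convex ℝ C) (hgC : ∀ x, g x ∈ C)
    {ε : ℝ} (hε : 0 < ε) :
    ∃ b : E → F, ContDiff ℝ ∞ b ∧ ∀ x, b x ∈ C ∧ dist (b x) (g x) < ε := by
  obtain ⟨b, hb⟩ := exists_contMDiffMap_forall_mem_convex_of_local_const (n := (⊤ : ℕ∞)) 𝓘(ℝ, E)
    (t := fun x => C ∩ Metric.ball (g x) ε) (fun x => hC.inter (convex_ball _ _)) fun x => by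
      refine ⟨g x, ?_⟩
      filter_upwards [hg.continuousAt.eventually (Metric.ball_mem_nhds (g x) hε)] with y hy
      exact ⟨hgC x, by rw [Metric.mem_ball, dist_comm]; exact hy⟩
  exact ⟨b, b.contMDiff.contDiff, fun x => hb x⟩

/-- Dominated convergence with the constant majorant `D ^ p`; no triangle inequality enters, so `p <
1` is covered. -/
theorem tendsto_eLpNorm_zero_of_tendsto_ae_of_bounded {α F : Type*} [MeasurableSpace α]
    {μ : Measure α} [IsFiniteMeasure μ] [NormedAddCommGroup F] {f : ℕ → α → F} {p : ℝ≥0∞}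
    (hp0 : 0 < p) (hp : p < ⊤) (hf : ∀ n, AEStronglyMeasurable (f n) μ) {D : ℝ≥0}
    (hD : ∀ n, ∀ᵐ x ∂μ, ‖f n x‖₊ ≤ D) (h : ∀ᵐ x ∂μ, Tendsto (fun n => f n x) atTop (𝓝 0)) :
    Tendsto (fun n => eLpNorm (f n) p μ) atTop (𝓝 0) := by
  have hq : 0 < p.toReal := ENNReal.toReal_pos hp0.ne' hp.ne
  simp_rw [eLpNorm_eq_lintegral_rpow_enorm_toReal hp0.ne' hp.ne]
  have h1 : Tendsto (fun n => ∫⁻ x, ‖f n x‖ₑ ^ p.toReal ∂μ) atTop (𝓝 (∫⁻ _, 0 ∂μ)) := by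
    refine tendsto_lintegral_of_dominated_convergence' (fun _ => (D : ℝ≥0∞) ^ p.toReal)
      (fun n => (hf n).enorm.pow_const _) (fun n => ?_) ?_ ?_
    · filter_upwards [hD n] with x hx
      exact ENNReal.rpow_le_rpow (ENNReal.coe_le_coe.2 hx) hq.le
    · rw [lintegral_const]
      exact ENNReal.mul_ne_top (ENNReal.rpow_ne_top_of_nonneg hq.le ENNReal.coe_ne_top)
        (measure_ne_top _ _)
    · filter_upwards [h] with x hx
      have h2 : Tendsto (fun n => ‖f n x‖ₑ) atTop (𝓝 0) := by simpa using hx.enorm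
      simpa [ENNReal.zero_rpow_of_pos hq, Function.comp_def] using
        ((ENNReal.continuous_rpow_const (y := p.toReal)).tendsto 0).comp h2
  rw [lintegral_zero] at h1
  have hq' : 0 < 1 / p.toReal := by positivity
  have h3 := ((ENNReal.continuous_rpow_const (y := 1 / p.toReal)).tendsto 0).comp h1
  rwa [ENNReal.zero_rpow_of_pos hq'] at h3

/-- A function with values in a bounded convex retract `C` is approximated in `L_p` by smooth
functions with values in `C`. -/
theorem exists_contDiff_mem_convex_eLpNorm_sub_lt {E F : Type*} [NormedAddCommGroup E]
    [NormedSpace ℝ E] [FiniteDimensional ℝ E] [MeasurableSpace E] [BorelSpace E]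
    [NormedAddCommGroup F] [NormedSpace ℝ F] {μ : Measure E} [IsFiniteMeasure μ]
    {C : Set F} (hC : Convex ℝ C) {R : ℝ} (hR : ∀ w ∈ C, ‖w‖ ≤ R) {ρ : F → F} (hρ : Continuous ρ)
    (hρC : ∀ w, ρ w ∈ C) (hρe : ∀ w ∈ C, ρ w = w) {f : E → F} (hf : AEStronglyMeasurable f μ)
    (hfC : ∀ᵐ x ∂μ, f x ∈ C) {p : ℝ≥0∞} (hp0 : 0 < p) (hp : p < ⊤) {ε : ℝ≥0∞} (hε : 0 < ε) :
    ∃ b : E → F, ContDiff ℝ ∞ b ∧ (∀ x, b x ∈ C) ∧ eLpNorm (fun x => f x - b x) p μ < ε := by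
  -- The detour through `L_1` and an almost everywhere convergent subsequence handles all `p` at
  -- once; boundedness of `C` then returns to `L_p`.
  have hfi : MemLp f 1 μ := MemLp.of_bound hf R (hfC.mono fun x hx => hR _ hx)
  have hn : ∀ n : ℕ, ((n : ℝ≥0∞) + 1)⁻¹ ≠ 0 := fun n => by
    rw [ne_eq, ENNReal.inv_eq_zero]; finiteness
  have hn0 : Tendsto (fun n : ℕ => ((n : ℝ≥0∞) + 1)⁻¹) atTop (𝓝 0) := by
    have := ENNReal.tendsto_inv_nat_nhds_zero.comp (tendsto_add_atTop_nat 1)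
    simpa [Function.comp_def] using this
  have hg := fun n => hfi.exists_boundedContinuous_eLpNorm_sub_le ENNReal.one_ne_top (hn n)
  choose g hgle hgm using hg
  have hmeas : TendstoInMeasure μ (fun n => (g n : E → F)) atTop f := by
    refine tendstoInMeasure_of_tendsto_eLpNorm one_ne_zero (fun n => (hgm n).1) hf ?_
    refine tendsto_of_tendsto_of_tendsto_of_le_of_le tendsto_const_nhds hn0
      (fun _ => zero_le) fun n => ?_
    simp only
    rw [eLpNorm_sub_comm]
    exact hgle n
  obtain ⟨ns, -, hns⟩ := hmeas.exists_seq_tendsto_ae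
  have hb := fun n : ℕ => (hρ.comp (g (ns n)).continuous).exists_contDiff_dist_lt_mem_convex hC
    (fun x => hρC _) (ε := 1 / ((n : ℝ) + 1)) (by positivity)
  choose b hbs hb using hb
  have hlim : Tendsto (fun n => eLpNorm (fun x => f x - b n x) p μ) atTop (𝓝 0) := by
    refine tendsto_eLpNorm_zero_of_tendsto_ae_of_bounded hp0 hp
      (fun n => hf.sub (hbs n).continuous.aestronglyMeasurable) (D := (R + R).toNNReal)
      (fun n => ?_) ?_
    · filter_upwards [hfC] with x hx
      rw [← NNReal.coe_le_coe]
      refine le_trans ?_ (Real.le_coe_toNNReal _)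
      exact (norm_sub_le _ _).trans (add_le_add (hR _ hx) (hR _ (hb n x).1))
    · filter_upwards [hfC, hns] with x hx hxs
      have h1 : Tendsto (fun n => ρ (g (ns n) x)) atTop (𝓝 (f x)) := by
        have := (hρ.tendsto (f x)).comp hxs
        rwa [hρe _ hx] at this
      have h2 : Tendsto (fun n => dist (b n x) (ρ (g (ns n) x))) atTop (𝓝 0) :=
        squeeze_zero (fun _ => dist_nonneg) (fun n => (hb n x).2.le)
          tendsto_one_div_add_atTop_nhds_zero_nat
      have h3 : Tendsto (fun n => b n x) atTop (𝓝 (f x)) := by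
        rw [tendsto_iff_dist_tendsto_zero]
        have h4 := h2.add (tendsto_iff_dist_tendsto_zero.1 h1)
        rw [add_zero] at h4
        exact squeeze_zero (fun _ => dist_nonneg) (fun n => dist_triangle _ _ _) h4
      simpa using h3.const_sub (f x)
  obtain ⟨n, hn⟩ := (hlim.eventually_lt_const hε).exists
  exact ⟨b n, hbs n, fun x => (hb n x).1, hn⟩

/-! ### Retraction onto a ball -/

/-- The radial retraction onto the closed ball of radius `r` around `0`. -/
noncomputable def radialRetraction {F : Type*} [NormedAddCommGroup F] [NormedSpace ℝ F]
    (r : ℝ) (x : F) : F := (r / max r ‖x‖) • x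

section radialRetraction

variable {F : Type*} [NormedAddCommGroup F] [NormedSpace ℝ F] {r : ℝ}

theorem continuous_radialRetraction (hr : 0 ≤ r) :
    Continuous (radialRetraction r : F → F) := by
  unfold radialRetraction
  -- For `r = 0`, which occurs when `m = M`, the denominator vanishes at the origin.
  rcases hr.eq_or_lt with rfl | hr
  · simpa using continuous_const
  · refine (continuous_const.div (continuous_const.max continuous_norm) fun x => ?_).smul
      continuous_id
    exact (hr.trans_le (le_max_left _ _)).ne'

theorem norm_radialRetraction_le (hr : 0 ≤ r) (x : F) : ‖radialRetraction r x‖ ≤ r := by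
  have hm : 0 ≤ max r ‖x‖ := hr.trans (le_max_left _ _)
  rw [radialRetraction, norm_smul, Real.norm_of_nonneg (div_nonneg hr hm), div_mul_eq_mul_div]
  exact div_le_of_le_mul₀ hm hr (mul_le_mul_of_nonneg_left (le_max_right _ _) hr)

theorem radialRetraction_of_norm_le {x : F} (hx : ‖x‖ ≤ r) : radialRetraction r x = x := by
  rw [radialRetraction, max_eq_left hx]
  rcases eq_or_ne r 0 with rfl | hr
  · simp [norm_le_zero_iff.1 hx]
  · rw [div_self hr, one_smul]

end radialRetraction

/-! ### Hermitian matrices with spectrum in an interval -/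

namespace Matrix

variable {n 𝕜 : Type*} [Fintype n] [DecidableEq n] [RCLike 𝕜] {A : Matrix n n 𝕜}

/-- The operator norm on matrices over `𝕜`, as a norm on a real vector space. -/
@[reducible]
noncomputable def l2OpRealNormedSpace : NormedSpace ℝ (Matrix n n 𝕜) where
  norm_smul_le c A := by
    have h : c • A = (c : 𝕜) • A := by
      ext i j
      simp [RCLike.real_smul_eq_coe_mul]
    rw [h, norm_smul, RCLike.norm_ofReal, Real.norm_eq_abs]

namespace IsHermitian

/-- Diagonalize: unitary conjugation preserves the operator norm and fixes `s • 1`. -/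
theorem norm_sub_smul_one_le_iff (hA : A.IsHermitian) {s r : ℝ} (hr : 0 ≤ r) :
    ‖A - (s : 𝕜) • (1 : Matrix n n 𝕜)‖ ≤ r ↔ ∀ i, |hA.eigenvalues i - s| ≤ r := by
  have h : A - (s : 𝕜) • (1 : Matrix n n 𝕜) = Unitary.conjStarAlgAut 𝕜 _ hA.eigenvectorUnitary
      (diagonal fun i => ((hA.eigenvalues i - s : ℝ) : 𝕜)) := by
    conv_lhs => rw [hA.spectral_theorem]
    rw [show (diagonal fun i => ((hA.eigenvalues i - s : ℝ) : 𝕜)) =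
      diagonal (RCLike.ofReal ∘ hA.eigenvalues) - (s : 𝕜) • (1 : Matrix n n 𝕜) by
        rw [smul_one_eq_diagonal, diagonal_sub]; simp, map_sub, map_smul, map_one]
  rw [h, Unitary.conjStarAlgAut_apply, ← Unitary.coe_star, CStarRing.norm_mul_coe_unitary,
    CStarRing.norm_coe_unitary_mul, l2_opNorm_diagonal, pi_norm_le_iff_of_nonneg hr]
  simp only [RCLike.norm_ofReal]

theorem norm_le_iff (hA : A.IsHermitian) {r : ℝ} (hr : 0 ≤ r) :
    ‖A‖ ≤ r ↔ ∀ i, |hA.eigenvalues i| ≤ r := by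
  simpa using hA.norm_sub_smul_one_le_iff (s := 0) hr

theorem norm_inv_le_iff (hA : A.IsHermitian) (hpos : ∀ i, 0 < hA.eigenvalues i) {r : ℝ}
    (hr : 0 ≤ r) : ‖A⁻¹‖ ≤ r ↔ ∀ i, (hA.eigenvalues i)⁻¹ ≤ r := by
  have h : A⁻¹ = Unitary.conjStarAlgAut 𝕜 _ hA.eigenvectorUnitary
      (diagonal fun i => (((hA.eigenvalues i)⁻¹ : ℝ) : 𝕜)) := by
    refine inv_eq_right_inv ?_
    conv_lhs => enter [1]; rw [hA.spectral_theorem]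
    rw [← map_mul, diagonal_mul_diagonal]
    have : (fun i => (RCLike.ofReal ∘ hA.eigenvalues) i * (((hA.eigenvalues i)⁻¹ : ℝ) : 𝕜)) =
        fun _ => 1 := by
      funext i
      rw [Function.comp_apply, ← RCLike.ofReal_mul, mul_inv_cancel₀ (hpos i).ne',
        RCLike.ofReal_one]
    rw [this, diagonal_one, map_one]
  rw [h, Unitary.conjStarAlgAut_apply, ← Unitary.coe_star, CStarRing.norm_mul_coe_unitary,
    CStarRing.norm_coe_unitary_mul, l2_opNorm_diagonal, pi_norm_le_iff_of_nonneg hr]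
  refine forall_congr' fun i => ?_
  rw [RCLike.norm_ofReal, abs_of_pos (inv_pos.2 (hpos i))]

theorem le_eigenvalues_of_posSemidef (hA : A.IsHermitian) {m : ℝ}
    (h : (A - (m : 𝕜) • (1 : Matrix n n 𝕜)).PosSemidef) (i : n) : m ≤ hA.eigenvalues i := by
  have h1 := h.re_dotProduct_nonneg (hA.eigenvectorBasis i).ofLp
  have h2 : star (hA.eigenvectorBasis i).ofLp ⬝ᵥ (hA.eigenvectorBasis i).ofLp = (1 : 𝕜) := by
    have := EuclideanSpace.inner_eq_star_dotProduct (hA.eigenvectorBasis i) (hA.eigenvectorBasis i)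
    rw [dotProduct_comm, ← this, inner_self_eq_norm_sq_to_K, hA.eigenvectorBasis.norm_eq_one]
    simp
  rw [sub_mulVec, dotProduct_sub, map_sub, ← hA.eigenvalues_eq, smul_mulVec, one_mulVec,
    dotProduct_smul, h2] at h1
  simpa using h1

end IsHermitian

/-- Hermitian matrices at distance at most `r` from `s • 1` in the operator norm. -/
def hermitianBall (n 𝕜 : Type*) [Fintype n] [DecidableEq n] [RCLike 𝕜] (s r : ℝ) :
    Set (Matrix n n 𝕜) :=
  {A | A.IsHermitian ∧ ‖A - (s : 𝕜) • (1 : Matrix n n 𝕜)‖ ≤ r}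

variable {s r : ℝ}

theorem isClosed_hermitianBall : IsClosed (hermitianBall n 𝕜 s r) := by
  refine IsClosed.inter ?_ ?_
  · exact isClosed_eq (continuous_id.matrix_conjTranspose) continuous_id
  · exact isClosed_le ((continuous_id.sub continuous_const).norm) continuous_const

theorem convex_hermitianBall : Convex ℝ (hermitianBall n 𝕜 s r) := by
  let _ : NormedSpace ℝ (Matrix n n 𝕜) := l2OpRealNormedSpace
  have h1 : hermitianBall n 𝕜 s r =
      (selfAdjoint.submodule ℝ (Matrix n n 𝕜) : Set (Matrix n n 𝕜)) ∩
        Metric.closedBall ((s : 𝕜) • (1 : Matrix n n 𝕜)) r := by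
    ext A
    simp only [hermitianBall, mem_ofPred_eq, mem_inter_iff, Metric.mem_closedBall, dist_eq_norm]
    rfl
  rw [h1]
  exact (Submodule.convex _).inter (convex_closedBall _ _)

theorem norm_le_of_mem_hermitianBall (hs : 0 ≤ s) (hA : A ∈ hermitianBall n 𝕜 s r) :
    ‖A‖ ≤ s + r := by
  have hr : 0 ≤ r := (norm_nonneg _).trans hA.2
  rw [hA.1.norm_le_iff (add_nonneg hs hr)]
  intro i
  have h := abs_le.1 ((hA.1.norm_sub_smul_one_le_iff hr).1 hA.2 i)
  exact abs_le.2 ⟨by linarith, by linarith⟩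

theorem le_eigenvalues_of_mem_hermitianBall (hA : A ∈ hermitianBall n 𝕜 s r) (i : n) :
    s - r ≤ hA.1.eigenvalues i := by
  have hr : 0 ≤ r := (norm_nonneg _).trans hA.2
  have h := abs_le.1 ((hA.1.norm_sub_smul_one_le_iff hr).1 hA.2 i)
  linarith

theorem posDef_of_mem_hermitianBall (hrs : r < s) (hA : A ∈ hermitianBall n 𝕜 s r) :
    A.PosDef :=
  hA.1.posDef_iff_eigenvalues_pos.2 fun i => by
    linarith [le_eigenvalues_of_mem_hermitianBall hA i]

theorem norm_inv_le_of_mem_hermitianBall (hrs : r < s) (hA : A ∈ hermitianBall n 𝕜 s r) :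
    ‖A⁻¹‖ ≤ (s - r)⁻¹ := by
  have h0 : 0 < s - r := sub_pos.2 hrs
  have h := le_eigenvalues_of_mem_hermitianBall hA
  rw [hA.1.norm_inv_le_iff (fun i => h0.trans_le (h i)) (inv_nonneg.2 h0.le)]
  exact fun i => inv_anti₀ h0 (h i)

/-- Take the Hermitian part, then retract radially towards `s • 1`; a real multiple of a Hermitian
matrix stays Hermitian. -/
theorem exists_continuous_retraction_hermitianBall (n 𝕜 : Type*) [Fintype n] [DecidableEq n]
    [RCLike 𝕜] (s : ℝ) {r : ℝ} (hr : 0 ≤ r) :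
    ∃ ρ : Matrix n n 𝕜 → Matrix n n 𝕜, Continuous ρ ∧ (∀ A, ρ A ∈ hermitianBall n 𝕜 s r) ∧
      ∀ A ∈ hermitianBall n 𝕜 s r, ρ A = A := by
  let _ : NormedSpace ℝ (Matrix n n 𝕜) := l2OpRealNormedSpace
  have hs : ((s : 𝕜) • (1 : Matrix n n 𝕜)).IsHermitian := by
    rw [IsHermitian, conjTranspose_smul, conjTranspose_one]
    simp
  refine ⟨fun A => (s : 𝕜) • (1 : Matrix n n 𝕜) + radialRetraction r
    ((1 / 2 : ℝ) • (A + Aᴴ) - (s : 𝕜) • (1 : Matrix n n 𝕜)), ?_, fun A => ⟨?_, ?_⟩, fun A hA => ?_⟩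
  · refine continuous_const.add ((continuous_radialRetraction hr).comp (Continuous.sub ?_
      continuous_const))
    exact (continuous_id.add continuous_id.matrix_conjTranspose).const_smul (1 / 2 : ℝ)
  · refine hs.add ?_
    unfold radialRetraction
    rw [IsHermitian, conjTranspose_smul, conjTranspose_sub, hs.eq, conjTranspose_smul,
      conjTranspose_add, conjTranspose_conjTranspose, add_comm Aᴴ A]
    simp
  · rw [add_sub_cancel_left]
    exact norm_radialRetraction_le hr _
  · have h1 : (1 / 2 : ℝ) • (A + Aᴴ) = A := by
      rw [hA.1.eq, ← two_smul ℝ A, smul_smul]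
      norm_num
    simp only
    rw [h1, radialRetraction_of_norm_le hA.2, add_sub_cancel]

end Matrix

/-! ### Assembly -/

/-- As `z → x`, both `b z` and `b (K.base z)` tend to `b x`, so `b` contributes nothing to the
limit. -/
theorem linftyContinuousAtBoundary_sub_of_continuous {d : ℕ}
    {Ω : Set (EuclideanSpace ℝ (Fin (d + 1)))} (K : CylindricalExit Ω) (hΩ : IsOpen Ω)
    {F : Type*} [NormedAddCommGroup F] [SecondCountableTopologyEither
      (EuclideanSpace ℝ (Fin (d + 1))) F]
    {a b : EuclideanSpace ℝ (Fin (d + 1)) → F} (ha : LinftyContinuousAtBoundary K a)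
    (hbc : Continuous b) {R : ℝ} (hR : ∀ y, ‖b y‖ ≤ R) :
    LinftyContinuousAtBoundary K (fun y => a y - b y) := by
  obtain ⟨⟨δ, hδ, h1⟩, h2, h3⟩ := ha
  have hbm : ∀ μ : Measure (EuclideanSpace ℝ (Fin (d + 1))), MemLp b ⊤ μ := fun μ =>
    memLp_top_of_bound hbc.aestronglyMeasurable R (Eventually.of_forall hR)
  refine ⟨⟨δ, hδ, h1.sub (hbm _)⟩, h2.sub (hbm _), fun x hx => ?_⟩
  have hxc : x ∈ closure Ω := frontier_subset_closure hx
  have hlim : Tendsto (fun z => b z - b (K.base z)) (𝓝[closure Ω] x) (𝓝 0) := by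
    have h4 : Tendsto b (𝓝[closure Ω] x) (𝓝 (b x)) := hbc.continuousAt.mono_left inf_le_left
    have h5 := (hbc.tendsto x).comp (K.tendsto_base hx)
    simpa using h4.sub h5
  have hb0 : Tendsto (fun δ : ℝ => eLpNorm (fun z => b z - b (K.base z)) ⊤
      (volume.restrict (Metric.ball x δ ∩ Ω))) (𝓝[>] 0) (𝓝 0) := by
    rw [ENNReal.tendsto_nhds_zero]
    intro ε hε
    obtain ⟨δ₀, hδ₀, hsub⟩ := Metric.mem_nhdsWithin_iff.1
      (hlim (Metric.closedEBall_mem_nhds (0 : F) hε))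
    filter_upwards [Ioo_mem_nhdsGT hδ₀] with η hη
    rw [eLpNorm_exponent_top]
    refine essSup_le_of_ae_le _ ?_
    rw [EventuallyLE, ae_restrict_iff' (Metric.isOpen_ball.inter hΩ).measurableSet]
    refine Eventually.of_forall fun z hz => ?_
    have := hsub ⟨Metric.ball_subset_ball hη.2.le hz.1, subset_closure hz.2⟩
    simpa using this
  have hsum := (h3 x hx).add hb0
  rw [add_zero] at hsum
  refine tendsto_of_tendsto_of_tendsto_of_le_of_le tendsto_const_nhds hsum
    (fun _ => zero_le) fun η => ?_
  simp only [eLpNorm_exponent_top]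
  refine le_trans (essSup_mono_ae (Eventually.of_forall fun z => ?_))
    (ENNReal.essSup_add_le _ _)
  calc ‖a z - b z - (a (K.base z) - b (K.base z))‖ₑ
      = ‖(a z - a (K.base z)) - (b z - b (K.base z))‖ₑ := by congr 1; abel
    _ ≤ _ := enorm_sub_le

open Matrix in
theorem exists_smooth_hermitianBall_approximation {𝕜 : Type*} [RCLike 𝕜] {d : ℕ}
    {Ω : Set (EuclideanSpace ℝ (Fin (d + 1)))} (hΩ : IsOpen Ω) (hb : Bornology.IsBounded Ω)
    (K : CylindricalExit Ω)
    {a : EuclideanSpace ℝ (Fin (d + 1)) → Matrix (Fin (d + 1)) (Fin (d + 1)) 𝕜}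
    (ha : LinftyContinuousAtBoundary K a) {s r : ℝ} (hs : 0 ≤ s) (hr : 0 ≤ r)
    (har : ∀ᵐ y ∂(volume.restrict Ω), a y ∈ hermitianBall (Fin (d + 1)) 𝕜 s r)
    {ε : ℝ} {p : ℝ≥0∞} (hε : 0 < ε) (hp0 : 0 < p) (hp : p < ⊤) :
    ∃ b : EuclideanSpace ℝ (Fin (d + 1)) → Matrix (Fin (d + 1)) (Fin (d + 1)) 𝕜,
      (∀ i j, ContDiff ℝ ∞ (fun y => b y i j)) ∧
      (∀ y, b y ∈ hermitianBall (Fin (d + 1)) 𝕜 s r) ∧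
      eLpNorm (fun y => a y - b y) p (surfaceMeasure Ω) < ENNReal.ofReal ε ∧
      LinftyContinuousAtBoundary K (fun y => a y - b y) := by
  let _ : NormedSpace ℝ (Matrix (Fin (d + 1)) (Fin (d + 1)) 𝕜) := l2OpRealNormedSpace
  have := K.isFiniteMeasure_surfaceMeasure hΩ hb
  obtain ⟨ρ, hρ, hρC, hρe⟩ := exists_continuous_retraction_hermitianBall (Fin (d + 1)) 𝕜 s hr
  obtain ⟨b, hbs, hbC, hbε⟩ := exists_contDiff_mem_convex_eLpNorm_sub_lt convex_hermitianBall
    (fun w hw => norm_le_of_mem_hermitianBall hs hw) hρ hρC hρe ha.2.1.1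
    (K.ae_mem_of_isClosed hΩ ha isClosed_hermitianBall har) hp0 hp (ENNReal.ofReal_pos.2 hε)
  refine ⟨b, fun i j => ?_, hbC, hbε, linftyContinuousAtBoundary_sub_of_continuous K hΩ ha
    hbs.continuous fun y => norm_le_of_mem_hermitianBall hs (hbC y)⟩
  let e : Matrix (Fin (d + 1)) (Fin (d + 1)) 𝕜 →L[ℝ] 𝕜 :=
    ⟨Matrix.entryLinearMap ℝ 𝕜 i j, continuous_id.matrix_elem i j⟩
  exact e.contDiff.comp hbs

open Matrix in
/-- The bounds on a uniformly positive matrix function that enter the norms of the function and of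
its inverse. -/
theorem UniformlyPositive.exists_le_eigenvalues {𝕜 : Type*} [RCLike 𝕜] {d : ℕ}
    {Ω : Set (EuclideanSpace ℝ (Fin (d + 1)))} [NeZero (volume.restrict Ω)]
    {a : EuclideanSpace ℝ (Fin (d + 1)) → Matrix (Fin (d + 1)) (Fin (d + 1)) 𝕜}
    (hu : UniformlyPositive Ω a) (hH : ∀ᵐ y ∂(volume.restrict Ω), (a y).IsHermitian) :
    ∃ m : ℝ, 0 < m ∧
      ENNReal.ofReal m⁻¹ ≤ eLpNorm (fun y => (a y)⁻¹) ⊤ (volume.restrict Ω) ∧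
      ∀ᵐ y ∂(volume.restrict Ω), ∀ (h : (a y).IsHermitian) (i : Fin (d + 1)),
        m ≤ h.eigenvalues i := by
  obtain ⟨m, hm, hpsd⟩ := hu
  set Q := eLpNorm (fun y => (a y)⁻¹) ⊤ (volume.restrict Ω) with hQ
  -- If `Q = ⊤` any positivity constant serves; otherwise the sharp choice is `m = Q⁻¹`.
  by_cases hQt : Q = ⊤
  · refine ⟨m, hm, by simp [hQt], ?_⟩
    filter_upwards [hpsd] with y hy h i
    exact h.le_eigenvalues_of_posSemidef hy i
  have hae : ∀ᵐ y ∂(volume.restrict Ω), ∀ (h : (a y).IsHermitian) (i : Fin (d + 1)),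
      0 < h.eigenvalues i ∧ (h.eigenvalues i)⁻¹ ≤ Q.toReal := by
    filter_upwards [hpsd, ae_le_eLpNormEssSup (f := fun y => (a y)⁻¹) (μ := volume.restrict Ω)]
      with y hy hyQ h i
    have hpos := fun i => hm.trans_le (h.le_eigenvalues_of_posSemidef hy i)
    refine ⟨hpos i, (h.norm_inv_le_iff hpos ENNReal.toReal_nonneg).1 ?_ i⟩
    rw [← eLpNorm_exponent_top, ← hQ] at hyQ
    simpa using ENNReal.toReal_mono hQt hyQ
  have hq : 0 < Q.toReal := by
    obtain ⟨y, hy, hyH⟩ := (hae.and hH).exists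
    exact (inv_pos.2 (hy hyH 0).1).trans_le (hy hyH 0).2
  refine ⟨Q.toReal⁻¹, inv_pos.2 hq, by rw [inv_inv, ENNReal.ofReal_toReal hQt], ?_⟩
  filter_upwards [hae] with y hy h i
  exact inv_le_of_inv_le₀ (hy h i).1 (hy h i).2

theorem lemma4p3 {𝕜 : Type*} [RCLike 𝕜] {d : ℕ}
    (Ω : Set (EuclideanSpace ℝ (Fin (d + 1))))
    (hΩ_open : IsOpen Ω) (hΩ_bdd : Bornology.IsBounded Ω) (hΩ_smooth : HasSmoothBoundary Ω)
    (K : CylindricalExit Ω) :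
    ∃ c : ℝ≥0,
      ∀ a : EuclideanSpace ℝ (Fin (d + 1)) → Matrix (Fin (d + 1)) (Fin (d + 1)) 𝕜,
        MemLp a ⊤ (volume.restrict Ω) →
        (∀ᵐ y ∂(volume.restrict Ω), (a y).IsHermitian) →
        LinftyContinuousAtBoundary K a →
        ∀ (ε : ℝ) (p : ℝ≥0∞), 0 < ε → 0 < p → p < ⊤ →
          ∃ b : EuclideanSpace ℝ (Fin (d + 1)) → Matrix (Fin (d + 1)) (Fin (d + 1)) 𝕜,
            (∀ i j, ContDiffOn ℝ ∞ (fun y => b y i j) (closure Ω)) ∧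
            (∀ y ∈ closure Ω, (b y).IsHermitian) ∧
            eLpNorm (fun y => a y - b y) p (surfaceMeasure Ω) < ENNReal.ofReal ε ∧
            LinftyContinuousAtBoundary K (fun y => a y - b y) ∧
            eLpNorm b ⊤ (volume.restrict Ω) ≤ c * eLpNorm a ⊤ (volume.restrict Ω) ∧
            (UniformlyPositive Ω a →
              (∀ y ∈ closure Ω, (b y).PosDef) ∧
              eLpNorm (fun y => (b y)⁻¹) ⊤ (volume.restrict Ω) ≤
                c * eLpNorm (fun y => (a y)⁻¹) ⊤ (volume.restrict Ω)) := by
  rcases Ω.eq_empty_or_nonempty with rfl | hne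
  · refine ⟨0, fun a _ _ _ ε p hε _ _ => ⟨fun _ => 0, ?_⟩⟩
    simp [surfaceMeasure, LinftyContinuousAtBoundary, hε]
    exact ⟨1, one_pos⟩
  have hvol : NeZero (volume.restrict Ω) :=
    ⟨by rw [ne_eq, Measure.restrict_eq_zero]; exact (hΩ_open.measure_pos volume hne).ne'⟩
  refine ⟨1, fun a ha hH hK ε p hε hp0 hp => ?_⟩
  set M := (eLpNorm a ⊤ (volume.restrict Ω)).toReal with hM
  have hM0 : 0 ≤ M := ENNReal.toReal_nonneg
  have hMa : ENNReal.ofReal M = eLpNorm a ⊤ (volume.restrict Ω) :=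
    ENNReal.ofReal_toReal ha.2.ne
  have haM : ∀ᵐ y ∂(volume.restrict Ω), ‖a y‖ ≤ M := by
    filter_upwards [ae_le_eLpNormEssSup (f := a) (μ := volume.restrict Ω)] with y hy
    rw [← eLpNorm_exponent_top] at hy
    exact (toReal_enorm (a y)).symm.trans_le (ENNReal.toReal_mono ha.2.ne hy)
  by_cases hu : UniformlyPositive Ω a
  · obtain ⟨m, hm, hmQ, hme⟩ := hu.exists_le_eigenvalues hH
    have hbd : ∀ᵐ y ∂(volume.restrict Ω), (a y).IsHermitian ∧
        ∀ (h : (a y).IsHermitian) (i : Fin (d + 1)),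
          m ≤ h.eigenvalues i ∧ h.eigenvalues i ≤ M := by
      filter_upwards [hH, haM, hme] with y hy hyM hym
      exact ⟨hy, fun h i => ⟨hym h i, (le_abs_self _).trans ((h.norm_le_iff hM0).1 hyM i)⟩⟩
    have hmM : m ≤ M := by
      obtain ⟨y, hy, hy'⟩ := hbd.exists
      exact (hy' hy 0).1.trans (hy' hy 0).2
    have hr : 0 ≤ (M - m) / 2 := by linarith
    -- Centre and radius satisfy `s + r = M` and `s - r = m`, so both norm bounds come out with
    -- constant `1`.
    obtain ⟨b, hbs, hbC, hbε, hbK⟩ := exists_smooth_hermitianBall_approximation hΩ_open hΩ_bdd K hK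
      (s := (M + m) / 2) (r := (M - m) / 2) (by linarith) hr (by
        filter_upwards [hbd] with y hy
        refine ⟨hy.1, (hy.1.norm_sub_smul_one_le_iff hr).2 fun i => ?_⟩
        have := hy.2 hy.1 i
        exact abs_le.2 ⟨by linarith, by linarith⟩) hε hp0 hp
    have hrs : (M - m) / 2 < (M + m) / 2 := by linarith
    refine ⟨b, fun i j => (hbs i j).contDiffOn, fun y _ => (hbC y).1, hbε, hbK, ?_, fun _ =>
      ⟨fun y _ => Matrix.posDef_of_mem_hermitianBall hrs (hbC y), ?_⟩⟩
    · rw [ENNReal.coe_one, one_mul, ← hMa, eLpNorm_exponent_top]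
      refine eLpNormEssSup_le_of_ae_bound (Eventually.of_forall fun y => ?_)
      refine (Matrix.norm_le_of_mem_hermitianBall (by linarith) (hbC y)).trans_eq ?_
      ring
    · rw [ENNReal.coe_one, one_mul, eLpNorm_exponent_top]
      refine le_trans (eLpNormEssSup_le_of_ae_bound (Eventually.of_forall fun y => ?_)) hmQ
      refine (Matrix.norm_inv_le_of_mem_hermitianBall hrs (hbC y)).trans_eq ?_
      ring
  · obtain ⟨b, hbs, hbC, hbε, hbK⟩ := exists_smooth_hermitianBall_approximation hΩ_open hΩ_bdd K hK
      (s := 0) (r := M) le_rfl hM0 (by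
        filter_upwards [hH, haM] with y hy hyM
        exact ⟨hy, by simpa using hyM⟩) hε hp0 hp
    refine ⟨b, fun i j => (hbs i j).contDiffOn, fun y _ => (hbC y).1, hbε, hbK, ?_,
      fun h => absurd h hu⟩
    rw [ENNReal.coe_one, one_mul, ← hMa, eLpNorm_exponent_top]
    refine eLpNormEssSup_le_of_ae_bound (Eventually.of_forall fun y => ?_)
    simpa using Matrix.norm_le_of_mem_hermitianBall le_rfl (hbC y)
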